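/- **Setting.** Let $\mathcal X\subset\mathbb R^m$ carry a pseudometric $d$, and let $\mathcal H$ be a real reproducing kernel Hilbert space of functions on $\mathcal X$ with (jointly measurable) kernel $k$. Let $f\in\mathcal H$ with $\|f\|_{\mathcal H}\le B$, and let $B,R,\lambda>0$, $\zeta\in(0,1)$, $T\in\mathbb N$, and $\tau\in\mathbb R$ with $\tau\le f(x)$ for some $x\in\mathcal X$. For $x\in\mathcal X$ and $\epsilon\in[-\infty,\infty]$ put $$\Delta_\epsilon(x)=\{x'-x:\ x'\in\mathcal X,\ d(x,x')\le\epsilon\},$$ and for $g:\mathcal X\to\mathbb R$ let the critical radius of $x$ be $$\epsilon_\tau[g](x)=\max\bigl\{d(x,x'):\ x'\in\mathcal X,\ g(x+\delta)\ge\tau\ \ \forall\delta\in\Delta_{d(x,x')}(x)\bigr\},$$ which is $-\infty$ if this set is empty (and is read as a supremum where the maximum is not attained). In each round $t=1,\dots,T$ the learner plays $\tilde x_t\in\mathcal X$, an adversary picks $\delta_t\in\Delta_{\epsilon_t}(\tilde x_t)$ with an unknown budget $\epsilon_t$, the point $x_t=\tilde x_t+\delta_t$ is sampled, and $y_t=f(x_t)+\eta_t$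 is observed. For a filtration $(\mathcal F_t)_{t\ge0}$, $x_t$ is $\mathcal F_{t-1}$-measurable, $\eta_t$ is $\mathcal F_t$-measurable, and $\eta_t$ is conditionally $R$-sub-Gaussian: $\mathbb E[e^{s\eta_t}\mid\mathcal F_{t-1}]\le e^{s^2R^2/2}$ a.s. for all $s\in\mathbb R$. Put $\boldsymbol K_t=(k(x_i,x_j))_{i,j\le t}$, $\boldsymbol k_t(x)=(k(x_i,x))_{i\le t}$, $\boldsymbol y_t=(y_i)_{i\le t}$, and $$\mu_t(x)=\boldsymbol k_t(x)^\top(\boldsymbol K_t+\lambda I)^{-1}\boldsymbol y_t,\qquad \sigma_t^2(x)=k(x,x)-\boldsymbol k_t(x)^\top(\boldsymbol K_t+\lambda I)^{-1}\boldsymbol k_t(x)$$ (so $\mu_0=0$ and $\sigma_0^2(x)=k(x,x)$). With $\bar\lambda=\max\{1,\lambda\}$ put $$\beta_t=B+\frac{R}{\sqrt\lambda}\sqrt{\log\det\Bigl(\frac{\bar\lambda}{\lambda}\boldsymbol K_{t-1}+\bar\lambda I\Bigr)+2\log\frac1\zeta},$$ $\mathrm{ucb}_t=\mu_{t-1}+\beta_t\sigma_{t-1}$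 and $\mathrm{lcb}_t=\mu_{t-1}-\beta_t\sigma_{t-1}$. Write $\epsilon_\tau(x)=\epsilon_\tau[f](x)$, $\overline\epsilon_{\tau,t}(x)=\epsilon_\tau[\mathrm{ucb}_t](x)$, $\underline\epsilon_{\tau,t}(x)=\epsilon_\tau[\mathrm{lcb}_t](x)$ for the true, optimistic and pessimistic critical radii, $\epsilon_\tau=\sup_x\epsilon_\tau(x)$ and $\overline\epsilon_{\tau,t}=\sup_x\overline\epsilon_{\tau,t}(x)$. The learner runs AdveRS-2: $\tilde x_t\in\arg\max_{x\in\mathcal X}\overline\epsilon_{\tau,t}(x)$. **Claim.** There is an event of probability at least $1-\zeta$ on which, for every $t\in\{1,\dots,T\}$: 1. $f(\tilde x_t+\delta)\ge\tau$ for all $\delta\in\Delta_{\underline\epsilon_{\tau,t}(\tilde x_t)}(\tilde x_t)$, provided that the maximum defining $\underline\epsilon_{\tau,t}(\tilde x_t)$ is attained or the set over which it is taken is empty; 2. if $\Delta_{\epsilon_\tau(\tilde x_t)}(\tilde x_t)\subsetneq\Delta_{\overline\epsilon_{\tau,t}}(\tilde x_t)$, then $f(\tilde x_t+\delta)\le\tau$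 for some $\delta\in\Delta_{\overline\epsilon_{\tau,t}}(\tilde x_t)$; the same conclusion holds if $\Delta_{\epsilon_\tau}(\tilde x_t)\subsetneq\Delta_{\overline\epsilon_{\tau,t}}(\tilde x_t)$. -/

import Mathlib

open MeasureTheory

noncomputable section

namespace RobustSatisficing

/-! ### Ambiguity balls and critical radii -/

/-- `d` is a pseudometric on `X`. -/
structure IsPseudometric {X : Type*} (d : X → X → ℝ) : Prop where
  self_eq_zero : ∀ x, d x x = 0
  symm : ∀ x y, d x y = d y x
  triangle : ∀ x y z, d x z ≤ d x y + d y z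

/-- The ambiguity ball `{x' - x : x' ∈ 𝒳, d(x, x') ≤ ε}`, a set of perturbations of `x`.
The radius is an extended real; for `ε = -∞` the ball is empty. -/
def ambiguityBall {m : ℕ} {𝒳 : Set (EuclideanSpace ℝ (Fin m))} (d : 𝒳 → 𝒳 → ℝ)
    (ε : EReal) (x : 𝒳) : Set (EuclideanSpace ℝ (Fin m)) :=
  {δ | ∃ x' : 𝒳, δ = (x' : EuclideanSpace ℝ (Fin m)) - x ∧ (d x x' : EReal) ≤ ε}

theorem add_mem_of_mem_ambiguityBall {m : ℕ} {𝒳 : Set (EuclideanSpace ℝ (Fin m))}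
    {d : 𝒳 → 𝒳 → ℝ} {ε : EReal} {x : 𝒳} {δ : EuclideanSpace ℝ (Fin m)}
    (h : δ ∈ ambiguityBall d ε x) : (x : EuclideanSpace ℝ (Fin m)) + δ ∈ 𝒳 := by
  obtain ⟨x', rfl, -⟩ := h
  simp

/-- The point `x + δ`, as a point of `𝒳`, for a perturbation `δ` in an ambiguity ball of `x`. -/
def perturb {m : ℕ} {𝒳 : Set (EuclideanSpace ℝ (Fin m))} {d : 𝒳 → 𝒳 → ℝ} {ε : EReal} {x : 𝒳}
    {δ : EuclideanSpace ℝ (Fin m)} (h : δ ∈ ambiguityBall d ε x) : 𝒳 :=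
  ⟨(x : EuclideanSpace ℝ (Fin m)) + δ, add_mem_of_mem_ambiguityBall h⟩

/-- The distances `d(x, x')`, `x' ∈ 𝒳`, such that `g (x + δ) ≥ τ` for all perturbations `δ` in
the ambiguity ball of radius `d(x, x')` around `x`. -/
def feasibleRadii {m : ℕ} {𝒳 : Set (EuclideanSpace ℝ (Fin m))} (d : 𝒳 → 𝒳 → ℝ) (τ : ℝ)
    (g : 𝒳 → ℝ) (x : 𝒳) : Set ℝ :=
  {r | ∃ x' : 𝒳, r = d x x' ∧
    ∀ δ, ∀ hδ : δ ∈ ambiguityBall d (d x x') x, τ ≤ g (perturb hδ)}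

/-- The critical radius of `x` for the function `g` and the threshold `τ`: the largest feasible
radius, and `-∞` if there is none. For `g = f`, `g = ucb_t`, `g = lcb_t` this is the true, the
optimistic and the pessimistic critical radius. -/
def criticalRadius {m : ℕ} {𝒳 : Set (EuclideanSpace ℝ (Fin m))} (d : 𝒳 → 𝒳 → ℝ) (τ : ℝ)
    (g : 𝒳 → ℝ) (x : 𝒳) : EReal :=
  sSup ((fun r : ℝ => (r : EReal)) '' feasibleRadii d τ g x)

/-- The maximum over the feasible radii is a genuine maximum (or there is no feasible radius, in
which case the critical radius is `-∞` by convention). -/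
def CriticalRadiusAttained {m : ℕ} {𝒳 : Set (EuclideanSpace ℝ (Fin m))} (d : 𝒳 → 𝒳 → ℝ) (τ : ℝ)
    (g : 𝒳 → ℝ) (x : 𝒳) : Prop :=
  (feasibleRadii d τ g x).Nonempty → ∃ r, IsGreatest (feasibleRadii d τ g x) r

/-- The largest critical radius of an action. -/
def maxCriticalRadius {m : ℕ} {𝒳 : Set (EuclideanSpace ℝ (Fin m))} (d : 𝒳 → 𝒳 → ℝ) (τ : ℝ)
    (g : 𝒳 → ℝ) : EReal :=
  ⨆ x : 𝒳, criticalRadius d τ g x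

/-! ### Gaussian process regression -/

/-- The real-valued reproducing kernel `k(x, x')` of a real RKHS `H` of functions on `X`. -/
def rkhsKernel {X : Type*} (H : Type*) [NormedAddCommGroup H] [InnerProductSpace ℝ H]
    [CompleteSpace H] [RKHS ℝ H X ℝ] (x x' : X) : ℝ :=
  RKHS.kernel H x x' (1 : ℝ)

/-- The kernel matrix `K_t` of the points `x_1, …, x_t`. -/
def kernelMatrix {X : Type*} (k : X → X → ℝ) (xs : ℕ → X) (t : ℕ) : Matrix (Fin t) (Fin t) ℝ :=
  Matrix.of fun i j => k (xs (i + 1)) (xs (j + 1))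

/-- The vector `(k(x_i, x))_{i = 1, …, t}`. -/
def kernelVec {X : Type*} (k : X → X → ℝ) (xs : ℕ → X) (t : ℕ) (x : X) : Fin t → ℝ :=
  fun i => k (xs (i + 1)) x

/-- The posterior mean `μ_t(x)` from the data `(x_i, y_i)`, `i = 1, …, t`. -/
def posteriorMean {X : Type*} (k : X → X → ℝ) (lam : ℝ) (xs : ℕ → X) (ys : ℕ → ℝ) (t : ℕ)
    (x : X) : ℝ :=
  kernelVec k xs t x ⬝ᵥ
    ((kernelMatrix k xs t + lam • (1 : Matrix (Fin t) (Fin t) ℝ))⁻¹).mulVec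
      (fun i : Fin t => ys (i + 1))

/-- The posterior covariance `k_t(x, x')` from the data points `x_1, …, x_t`. -/
def posteriorCov {X : Type*} (k : X → X → ℝ) (lam : ℝ) (xs : ℕ → X) (t : ℕ) (x x' : X) : ℝ :=
  k x x' - kernelVec k xs t x ⬝ᵥ
    ((kernelMatrix k xs t + lam • (1 : Matrix (Fin t) (Fin t) ℝ))⁻¹).mulVec
      (kernelVec k xs t x')

/-- The posterior standard deviation `σ_t(x)`. -/
def posteriorStd {X : Type*} (k : X → X → ℝ) (lam : ℝ) (xs : ℕ → X) (t : ℕ) (x : X) : ℝ :=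
  Real.sqrt (posteriorCov k lam xs t x x)

/-- The exploration parameter
`β_t = B + R / √λ * √(log det ((λ̄ / λ) K_{t-1} + λ̄ I) + 2 log (1 / ζ))`, `λ̄ = max 1 λ`. -/
def beta {X : Type*} (k : X → X → ℝ) (lam B R ζ : ℝ) (xs : ℕ → X) (t : ℕ) : ℝ :=
  B + R / Real.sqrt lam * Real.sqrt
    (Real.log (((max 1 lam / lam) • kernelMatrix k xs (t - 1) +
        max 1 lam • (1 : Matrix (Fin (t - 1)) (Fin (t - 1)) ℝ)).det)
      + 2 * Real.log (1 / ζ))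

/-- The upper confidence bound `ucb_t(x) = μ_{t-1}(x) + β_t σ_{t-1}(x)`, for `t ≥ 1`. -/
def ucb {X : Type*} (k : X → X → ℝ) (lam B R ζ : ℝ) (xs : ℕ → X) (ys : ℕ → ℝ) (t : ℕ)
    (x : X) : ℝ :=
  posteriorMean k lam xs ys (t - 1) x +
    beta k lam B R ζ xs t * posteriorStd k lam xs (t - 1) x

/-- The lower confidence bound `lcb_t(x) = μ_{t-1}(x) - β_t σ_{t-1}(x)`, for `t ≥ 1`. -/
def lcb {X : Type*} (k : X → X → ℝ) (lam B R ζ : ℝ) (xs : ℕ → X) (ys : ℕ → ℝ) (t : ℕ)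
    (x : X) : ℝ :=
  posteriorMean k lam xs ys (t - 1) x -
    beta k lam B R ζ xs t * posteriorStd k lam xs (t - 1) x

/-! ### The interaction of the learner with the adversary -/

/-- `X` is `R`-sub-Gaussian conditionally on the σ-algebra `m`:
`E[exp (s X) | m] ≤ exp (s² R² / 2)` almost surely, for every real `s`. -/
def IsCondSubgaussian {Ω : Type*} {mΩ : MeasurableSpace Ω} (P : Measure Ω)
    (m : MeasurableSpace Ω) (R : ℝ) (X : Ω → ℝ) : Prop :=
  ∀ s : ℝ, Integrable (fun ω => Real.exp (s * X ω)) P ∧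
    P[fun ω => Real.exp (s * X ω) | m] ≤ᵐ[P] fun _ => Real.exp (s ^ 2 * R ^ 2 / 2)

/-- A run of AdveRS-2 over the rounds `1, …, T`. `ℱ t` is the information available after the
observation of round `t` and before the noise of round `t + 1`. In round `t` the learner plays
`xt t`, the adversary answers with the perturbation `δ t` of size at most its budget `ε t`, the
point `x t = xt t + δ t` is sampled, and `y t = f (x t) + η t` is observed. The learner's action
maximizes the optimistic critical radius. -/
structure IsAdveRS2Run {Ω : Type*} [MeasurableSpace Ω] (P : Measure Ω) {m : ℕ}
    {𝒳 : Set (EuclideanSpace ℝ (Fin m))} (d k : 𝒳 → 𝒳 → ℝ) (f : 𝒳 → ℝ) (τ lam B R ζ : ℝ) (T : ℕ)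
    (ℱ : Filtration ℕ (inferInstance : MeasurableSpace Ω)) (ε : ℕ → Ω → ℝ)
    (xt : ℕ → Ω → 𝒳) (δ : ℕ → Ω → EuclideanSpace ℝ (Fin m)) (x : ℕ → Ω → 𝒳)
    (y η : ℕ → Ω → ℝ) : Prop where
  action : ∀ t ∈ Finset.Icc 1 T, ∀ ω,
    IsMaxOn (criticalRadius d τ (ucb k lam B R ζ (fun i => x i ω) (fun i => y i ω) t))
      Set.univ (xt t ω)
  perturbation : ∀ t ∈ Finset.Icc 1 T, ∀ ω, δ t ω ∈ ambiguityBall d (ε t ω) (xt t ω)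
  sample : ∀ t ∈ Finset.Icc 1 T, ∀ ω,
    (x t ω : EuclideanSpace ℝ (Fin m)) = (xt t ω : EuclideanSpace ℝ (Fin m)) + δ t ω
  observation : ∀ t ∈ Finset.Icc 1 T, ∀ ω, y t ω = f (x t ω) + η t ω
  measurable_sample : ∀ t ∈ Finset.Icc 1 T, Measurable[ℱ (t - 1)] (x t)
  measurable_noise : ∀ t ∈ Finset.Icc 1 T, Measurable[ℱ t] (η t)
  noise : ∀ t ∈ Finset.Icc 1 T, IsCondSubgaussian P (ℱ (t - 1)) R (η t)

end RobustSatisficing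

end

/-! The randomness enters through one event, on which `lcb_t ≤ f ≤ ucb_t` at every point and in
every round (`exists_event_confidence_bounds`). On it, claim 1 holds because `lcb_t ≥ τ` on the
pessimistic ball. Claim 2 is deterministic: if `f > τ` on a ball strictly containing the critical
one, some distance beyond the critical radius would be feasible.

For the event, write `k` as an inner product of features. The error of `μ_n` splits into a
noise-free part, at most `‖f‖ σ_n`, and the regression of the noise `z`, at most `σ_n √(Q_n / λ)`
with `Q_n = zᵀ K_n (K_n + λ I)⁻¹ z` (`abs_sub_posteriorMean_add_le`). It remains to bound `Q_n` for
all `n` at once.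

This is the method of mixtures, carried out one round at a time. Given the past, let `a` and `c` be
the posterior mean and variance of the noise regression at the next sample. Sub-Gaussianity bounds
the conditional mean of `exp (w z / R² - w² / (2 R²))` by 1, and averaging over `w ∼ N(a, R² c / λ)`
keeps this bound. The product of these averages is therefore a supermartingale started at 1, and it
equals `det(I + K_n / λ)^(-1/2) exp (Q_n / (2 R²))` (`prod_mixtureFactor_eq`). Ville's inequality at
level `1 / ζ` then bounds `Q_n` by the logarithm that appears in `β`. -/

noncomputable section

namespace RobustSatisficing

open Matrix
open scoped InnerProductSpace

/-! ### Kernel ridge regression -/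

/-- The regularized kernel matrix `K_t + λ I`. -/
def regMatrix {X : Type*} (k : X → X → ℝ) (lam : ℝ) (xs : ℕ → X) (t : ℕ) :
    Matrix (Fin t) (Fin t) ℝ :=
  kernelMatrix k xs t + lam • (1 : Matrix (Fin t) (Fin t) ℝ)

/-- The quadratic form `zᵀ K_t (K_t + λ I)⁻¹ z` of the noise vector `z = (z_1, …, z_t)`. -/
def noiseQuad {X : Type*} (k : X → X → ℝ) (lam : ℝ) (xs : ℕ → X) (zs : ℕ → ℝ) (t : ℕ) : ℝ :=
  (fun i : Fin t => zs (i + 1)) ⬝ᵥ (fun i : Fin t => zs (i + 1)) -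
    lam * ((fun i : Fin t => zs (i + 1)) ⬝ᵥ
      (regMatrix k lam xs t)⁻¹ *ᵥ (fun i : Fin t => zs (i + 1)))

section FeatureMap

variable {X E : Type*} [NormedAddCommGroup E] [InnerProductSpace ℝ E] {k : X → X → ℝ} {φ : X → E}
  {lam : ℝ}

theorem inner_sum_feature (hφ : ∀ x y, k x y = ⟪φ x, φ y⟫_ℝ) (xs : ℕ → X) (n : ℕ)
    (x : X) (v : Fin n → ℝ) :
    ⟪φ x, ∑ i : Fin n, v i • φ (xs (i + 1))⟫_ℝ = kernelVec k xs n x ⬝ᵥ v := by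
  rw [inner_sum]
  simp only [inner_smul_right, dotProduct, kernelVec, hφ]
  exact Finset.sum_congr rfl fun i _ => by rw [real_inner_comm, mul_comm]

theorem kernelMatrix_mulVec_apply (hφ : ∀ x y, k x y = ⟪φ x, φ y⟫_ℝ) (xs : ℕ → X) (n : ℕ)
    (v : Fin n → ℝ) (i : Fin n) :
    (kernelMatrix k xs n *ᵥ v) i =
      ⟪φ (xs (i + 1)), ∑ j : Fin n, v j • φ (xs (j + 1))⟫_ℝ := by
  rw [mulVec, dotProduct, inner_sum]
  refine Finset.sum_congr rfl fun j _ => ?_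
  rw [inner_smul_right, kernelMatrix, Matrix.of_apply, hφ, mul_comm]

theorem dotProduct_kernelMatrix_mulVec (hφ : ∀ x y, k x y = ⟪φ x, φ y⟫_ℝ) (xs : ℕ → X) (n : ℕ)
    (w v : Fin n → ℝ) :
    w ⬝ᵥ kernelMatrix k xs n *ᵥ v =
      ⟪∑ i : Fin n, w i • φ (xs (i + 1)), ∑ i : Fin n, v i • φ (xs (i + 1))⟫_ℝ := by
  rw [sum_inner]
  refine Finset.sum_congr rfl fun i _ => ?_
  rw [inner_smul_left, kernelMatrix_mulVec_apply hφ, RCLike.conj_to_real]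

theorem kernelMatrix_isHermitian (hφ : ∀ x y, k x y = ⟪φ x, φ y⟫_ℝ) (xs : ℕ → X) (n : ℕ) :
    (kernelMatrix k xs n).IsHermitian := by
  ext i j
  simp [kernelMatrix, hφ, real_inner_comm]

theorem posDef_regMatrix (hφ : ∀ x y, k x y = ⟪φ x, φ y⟫_ℝ) (hlam : 0 < lam) (xs : ℕ → X)
    (n : ℕ) : (regMatrix k lam xs n).PosDef := by
  refine Matrix.PosDef.posSemidef_add ?_ (Matrix.PosDef.one.smul hlam)
  refine Matrix.PosSemidef.of_dotProduct_mulVec_nonneg (kernelMatrix_isHermitian hφ xs n)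
    fun v => ?_
  rw [star_trivial, dotProduct_kernelMatrix_mulVec hφ]
  exact real_inner_self_nonneg

theorem isUnit_det_regMatrix (hφ : ∀ x y, k x y = ⟪φ x, φ y⟫_ℝ) (hlam : 0 < lam) (xs : ℕ → X)
    (n : ℕ) : IsUnit (regMatrix k lam xs n).det :=
  (posDef_regMatrix hφ hlam xs n).det_pos.ne'.isUnit

theorem regMatrix_mulVec (xs : ℕ → X) (n : ℕ) (v : Fin n → ℝ) :
    regMatrix k lam xs n *ᵥ v = kernelMatrix k xs n *ᵥ v + lam • v := by
  rw [regMatrix, add_mulVec, smul_mulVec, one_mulVec]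

theorem regMatrix_mulVec_inv_mulVec (hφ : ∀ x y, k x y = ⟪φ x, φ y⟫_ℝ) (hlam : 0 < lam)
    (xs : ℕ → X) (n : ℕ) (v : Fin n → ℝ) :
    regMatrix k lam xs n *ᵥ ((regMatrix k lam xs n)⁻¹ *ᵥ v) = v := by
  rw [mulVec_mulVec, mul_nonsing_inv _ (isUnit_det_regMatrix hφ hlam xs n), one_mulVec]

theorem dotProduct_inv_regMatrix_comm (hφ : ∀ x y, k x y = ⟪φ x, φ y⟫_ℝ) (hlam : 0 < lam)
    (xs : ℕ → X) (n : ℕ) (v w : Fin n → ℝ) :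
    v ⬝ᵥ (regMatrix k lam xs n)⁻¹ *ᵥ w = w ⬝ᵥ (regMatrix k lam xs n)⁻¹ *ᵥ v := by
  have h := (posDef_regMatrix hφ hlam xs n).isHermitian.inv
  rw [dotProduct_mulVec, ← mulVec_transpose, dotProduct_comm]
  congr 2

/-- The residual `φ(x) - ∑ w_i φ(x_i)` of the regression weights `w = (K_t + λ I)⁻¹ k_t(x)`. -/
def residual (k : X → X → ℝ) (φ : X → E) (lam : ℝ) (xs : ℕ → X) (n : ℕ) (x : X) : E :=
  φ x - ∑ i : Fin n, ((regMatrix k lam xs n)⁻¹ *ᵥ kernelVec k xs n x) i • φ (xs (i + 1))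

/-- The posterior variance is the minimum of the ridge objective `‖φ x - ∑ v_i φ(x_i)‖² + λ ‖v‖²`,
attained at the regression weights. The first summand controls the noise-free error; both are needed
for the noise. -/
theorem posteriorCov_self_eq (hφ : ∀ x y, k x y = ⟪φ x, φ y⟫_ℝ) (hlam : 0 < lam) (xs : ℕ → X)
    (n : ℕ) (x : X) :
    posteriorCov k lam xs n x x = ‖residual k φ lam xs n x‖ ^ 2 +
      lam * (((regMatrix k lam xs n)⁻¹ *ᵥ kernelVec k xs n x) ⬝ᵥ
        ((regMatrix k lam xs n)⁻¹ *ᵥ kernelVec k xs n x)) := by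
  have hcov : posteriorCov k lam xs n x x =
      k x x - kernelVec k xs n x ⬝ᵥ ((regMatrix k lam xs n)⁻¹ *ᵥ kernelVec k xs n x) := rfl
  have hw := regMatrix_mulVec_inv_mulVec hφ hlam xs n (kernelVec k xs n x)
  rw [hcov, residual]
  generalize (regMatrix k lam xs n)⁻¹ *ᵥ kernelVec k xs n x = w at hw ⊢
  rw [@norm_sub_sq_real, inner_sum_feature hφ, ← real_inner_self_eq_norm_sq, ← hφ,
    ← real_inner_self_eq_norm_sq, ← dotProduct_kernelMatrix_mulVec hφ]
  have h2 : w ⬝ᵥ kernelVec k xs n x = w ⬝ᵥ kernelMatrix k xs n *ᵥ w + lam * (w ⬝ᵥ w) := by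
    conv_lhs => rw [← hw, regMatrix_mulVec, dotProduct_add, dotProduct_smul, smul_eq_mul]
  rw [dotProduct_comm (kernelVec k xs n x) w]
  linarith

theorem posteriorCov_self_nonneg (hφ : ∀ x y, k x y = ⟪φ x, φ y⟫_ℝ) (hlam : 0 < lam)
    (xs : ℕ → X) (n : ℕ) (x : X) : 0 ≤ posteriorCov k lam xs n x x := by
  rw [posteriorCov_self_eq hφ hlam]
  have := dotProduct_star_self_nonneg ((regMatrix k lam xs n)⁻¹ *ᵥ kernelVec k xs n x)
  rw [star_trivial] at this
  positivity

theorem norm_residual_le (hφ : ∀ x y, k x y = ⟪φ x, φ y⟫_ℝ) (hlam : 0 < lam) (xs : ℕ → X)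
    (n : ℕ) (x : X) : ‖residual k φ lam xs n x‖ ≤ posteriorStd k lam xs n x := by
  refine Real.le_sqrt_of_sq_le ?_
  rw [posteriorCov_self_eq hφ hlam]
  have := dotProduct_star_self_nonneg ((regMatrix k lam xs n)⁻¹ *ᵥ kernelVec k xs n x)
  rw [star_trivial] at this
  have := mul_nonneg hlam.le this
  linarith

/-- Without noise, the regression error is at most `B σ_t(x)`. -/
theorem abs_sub_posteriorMean_le (hφ : ∀ x y, k x y = ⟪φ x, φ y⟫_ℝ) (hlam : 0 < lam)
    (xs : ℕ → X) (n : ℕ) (x : X) (f : E) :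
    |⟪φ x, f⟫_ℝ - posteriorMean k lam xs (fun i => ⟪φ (xs i), f⟫_ℝ) n x| ≤
      ‖f‖ * posteriorStd k lam xs n x := by
  have h : ⟪φ x, f⟫_ℝ - posteriorMean k lam xs (fun i => ⟪φ (xs i), f⟫_ℝ) n x =
      ⟪residual k φ lam xs n x, f⟫_ℝ := by
    rw [residual, inner_sub_left, sum_inner]
    congr 1
    refine (dotProduct_inv_regMatrix_comm hφ hlam xs n _ _).trans ?_
    refine Finset.sum_congr rfl fun i _ => ?_
    rw [inner_smul_left, RCLike.conj_to_real, mul_comm]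
  rw [h, mul_comm]
  exact (abs_real_inner_le_norm _ _).trans
    (mul_le_mul_of_nonneg_right (norm_residual_le hφ hlam xs n x) (norm_nonneg f))

/-- Inserting `z = K u + λ u` reduces the form to `z ⬝ K u`. The two summands match those of
`posteriorCov_self_eq`, ready for Cauchy–Schwarz. -/
theorem noiseQuad_eq (hφ : ∀ x y, k x y = ⟪φ x, φ y⟫_ℝ) (hlam : 0 < lam)
    (xs : ℕ → X) (zs : ℕ → ℝ) (n : ℕ) (u : Fin n → ℝ)
    (hu : u = (regMatrix k lam xs n)⁻¹ *ᵥ (fun i : Fin n => zs (i + 1))) :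
    noiseQuad k lam xs zs n = lam * ‖∑ i : Fin n, u i • φ (xs (i + 1))‖ ^ 2 +
      (kernelMatrix k xs n *ᵥ u) ⬝ᵥ (kernelMatrix k xs n *ᵥ u) := by
  have hz := regMatrix_mulVec_inv_mulVec hφ hlam xs n (fun i : Fin n => zs (i + 1))
  rw [← real_inner_self_eq_norm_sq, ← dotProduct_kernelMatrix_mulVec hφ, noiseQuad, ← hu]
  rw [← hu, regMatrix_mulVec] at hz
  rw [← hz]
  simp only [dotProduct_add, add_dotProduct, smul_dotProduct, dotProduct_smul, smul_eq_mul]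
  rw [dotProduct_comm (kernelMatrix k xs n *ᵥ u) u]
  ring

theorem mul_add_mul_le_sqrt_mul_sqrt {a b c d : ℝ} {s t : ℝ} (hs : a ^ 2 + b ^ 2 ≤ s)
    (ht : c ^ 2 + d ^ 2 ≤ t) : a * c + b * d ≤ √s * √t := by
  rw [← Real.sqrt_mul ((by positivity : 0 ≤ a ^ 2 + b ^ 2).trans hs)]
  refine Real.le_sqrt_of_sq_le ?_
  refine le_trans ?_ (mul_le_mul hs ht (by positivity)
    ((by positivity : 0 ≤ a ^ 2 + b ^ 2).trans hs))
  nlinarith [sq_nonneg (a * d - b * c)]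

/-- The regression of pure noise is at most `σ_t(x) √(zᵀ K_t (K_t + λ I)⁻¹ z / λ)`. -/
theorem abs_posteriorMean_le (hφ : ∀ x y, k x y = ⟪φ x, φ y⟫_ℝ) (hlam : 0 < lam)
    (xs : ℕ → X) (zs : ℕ → ℝ) (n : ℕ) (x : X) :
    |posteriorMean k lam xs zs n x| ≤
      posteriorStd k lam xs n x * √(noiseQuad k lam xs zs n / lam) := by
  obtain ⟨u, hu⟩ : ∃ u, u = (regMatrix k lam xs n)⁻¹ *ᵥ (fun i : Fin n => zs (i + 1)) := ⟨_, rfl⟩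
  obtain ⟨w, hw⟩ : ∃ w, w = (regMatrix k lam xs n)⁻¹ *ᵥ kernelVec k xs n x := ⟨_, rfl⟩
  -- The mean is `⟪φ x, U⟫` with `U = ∑ u_i φ(x_i)`; splitting `φ x` into its residual and its fit
  -- `∑ w_i φ(x_i)` gives the two terms.
  have hmean : posteriorMean k lam xs zs n x =
      ⟪residual k φ lam xs n x, ∑ i : Fin n, u i • φ (xs (i + 1))⟫_ℝ +
        w ⬝ᵥ (kernelMatrix k xs n *ᵥ u) := by
    rw [residual, inner_sub_left, inner_sum_feature hφ, ← hw, dotProduct_kernelMatrix_mulVec hφ,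
      sub_add_cancel, hu]
    rfl
  have hcov := posteriorCov_self_eq hφ hlam xs n x
  rw [← hw] at hcov
  have hq := noiseQuad_eq hφ hlam xs zs n u hu
  have hcs : |w ⬝ᵥ (kernelMatrix k xs n *ᵥ u)| ≤
      √(w ⬝ᵥ w) * √((kernelMatrix k xs n *ᵥ u) ⬝ᵥ (kernelMatrix k xs n *ᵥ u)) := by
    have h := abs_real_inner_le_norm (WithLp.toLp 2 (kernelMatrix k xs n *ᵥ u))
      (WithLp.toLp 2 w)
    rw [EuclideanSpace.norm_eq, EuclideanSpace.norm_eq] at h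
    simpa [EuclideanSpace.inner_toLp_toLp, dotProduct, pow_two, mul_comm] using h
  have hw0 : 0 ≤ w ⬝ᵥ w := by simpa using dotProduct_star_self_nonneg w
  have hp0 : 0 ≤ (kernelMatrix k xs n *ᵥ u) ⬝ᵥ (kernelMatrix k xs n *ᵥ u) := by
    simpa using dotProduct_star_self_nonneg (kernelMatrix k xs n *ᵥ u)
  generalize (kernelMatrix k xs n *ᵥ u) = p at *
  have hsl : √lam ≠ 0 := (Real.sqrt_pos.2 hlam).ne'
  -- The factor `√λ` is moved between `b` and `d` so that `a² + b²` is the posterior variance and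
  -- `c² + d²` is `Q / λ`.
  have key := mul_add_mul_le_sqrt_mul_sqrt (a := ‖residual k φ lam xs n x‖)
    (b := √lam * √(w ⬝ᵥ w)) (c := ‖∑ i : Fin n, u i • φ (xs (i + 1))‖)
    (d := √(p ⬝ᵥ p) / √lam) (s := posteriorCov k lam xs n x x)
    (t := noiseQuad k lam xs zs n / lam)
    (by rw [hcov, mul_pow, Real.sq_sqrt hlam.le, Real.sq_sqrt hw0])
    (by rw [hq, div_pow, Real.sq_sqrt hlam.le, Real.sq_sqrt hp0, add_div,
          mul_div_cancel_left₀ _ hlam.ne'])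
  rw [hmean]
  refine (abs_add_le _ _).trans (le_trans (add_le_add (abs_real_inner_le_norm _ _) hcs) ?_)
  refine le_trans (le_of_eq ?_) key
  field_simp

theorem abs_sub_posteriorMean_add_le (hφ : ∀ x y, k x y = ⟪φ x, φ y⟫_ℝ) (hlam : 0 < lam)
    (xs : ℕ → X) (ys zs : ℕ → ℝ) (n : ℕ) (x : X) (f : E)
    (hy : ∀ i, 1 ≤ i → i ≤ n → ys i = ⟪φ (xs i), f⟫_ℝ + zs i) :
    |⟪φ x, f⟫_ℝ - posteriorMean k lam xs ys n x| ≤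
      (‖f‖ + √(noiseQuad k lam xs zs n / lam)) * posteriorStd k lam xs n x := by
  have h : posteriorMean k lam xs ys n x =
      posteriorMean k lam xs (fun i => ⟪φ (xs i), f⟫_ℝ) n x + posteriorMean k lam xs zs n x := by
    simp only [posteriorMean]
    rw [← dotProduct_add, ← mulVec_add]
    congr 2
    funext i
    exact hy _ (by omega) (by omega)
  rw [h, ← sub_sub, add_mul, mul_comm (√_)]
  exact (abs_sub _ _).trans (add_le_add (abs_sub_posteriorMean_le hφ hlam xs n x f)
    (abs_posteriorMean_le hφ hlam xs zs n x))

/-! ### Adding one data point -/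

/-- The new matrix is the old one bordered by `k_n(x_{n+1})`, and the Schur complement of the old
block is `λ` plus the posterior variance at the new point. -/
theorem det_regMatrix_succ (hφ : ∀ x y, k x y = ⟪φ x, φ y⟫_ℝ) (hlam : 0 < lam) (xs : ℕ → X)
    (n : ℕ) :
    (regMatrix k lam xs (n + 1)).det = (regMatrix k lam xs n).det *
      (lam + posteriorCov k lam xs n (xs (n + 1)) (xs (n + 1))) := by
  have hblock : (regMatrix k lam xs (n + 1)).submatrix finSumFinEquiv finSumFinEquiv =
      fromBlocks (regMatrix k lam xs n)
        (Matrix.of fun i (_ : Fin 1) => kernelVec k xs n (xs (n + 1)) i)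
        (Matrix.of fun (_ : Fin 1) i => kernelVec k xs n (xs (n + 1)) i)
        (Matrix.of fun _ _ => k (xs (n + 1)) (xs (n + 1)) + lam) := by
    ext (i | i) (j | j)
    · simp [regMatrix, kernelMatrix, Matrix.one_apply, Fin.ext_iff]
    · have : (i : ℕ) ≠ n := i.2.ne
      simp [regMatrix, kernelMatrix, Fin.ext_iff, kernelVec, this]
    · have : n ≠ (j : ℕ) := j.2.ne'
      simp [regMatrix, kernelMatrix, Fin.ext_iff, kernelVec, this, hφ,
        real_inner_comm]
    · have hi : i = 0 := Subsingleton.elim _ _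
      have hj : j = 0 := Subsingleton.elim _ _
      simp [regMatrix, kernelMatrix, hi, hj]
  rw [← det_submatrix_equiv_self finSumFinEquiv (regMatrix k lam xs (n + 1)), hblock]
  have := invertibleOfIsUnitDet _ (isUnit_det_regMatrix hφ hlam xs n)
  rw [det_fromBlocks₁₁, invOf_eq_nonsing_inv, det_fin_one, Matrix.mul_assoc]
  congr 1
  have : posteriorCov k lam xs n (xs (n + 1)) (xs (n + 1)) = k (xs (n + 1)) (xs (n + 1)) -
    kernelVec k xs n (xs (n + 1)) ⬝ᵥ
      ((regMatrix k lam xs n)⁻¹ *ᵥ kernelVec k xs n (xs (n + 1))) := rfl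
  rw [this]
  simp only [Matrix.sub_apply, of_apply, Matrix.mul_apply, dotProduct, mulVec]
  ring

/-- A new observation enters through its squared prediction error over its predictive variance,
found by solving the bordered linear system explicitly. -/
theorem noiseQuad_succ (hφ : ∀ x y, k x y = ⟪φ x, φ y⟫_ℝ) (hlam : 0 < lam) (xs : ℕ → X)
    (zs : ℕ → ℝ) (n : ℕ) :
    noiseQuad k lam xs zs (n + 1) = noiseQuad k lam xs zs n + zs (n + 1) ^ 2 -
      lam * (zs (n + 1) - posteriorMean k lam xs zs n (xs (n + 1))) ^ 2 /
        (lam + posteriorCov k lam xs n (xs (n + 1)) (xs (n + 1))) := by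
  have hs : 0 < lam + posteriorCov k lam xs n (xs (n + 1)) (xs (n + 1)) :=
    add_pos_of_pos_of_nonneg hlam (posteriorCov_self_nonneg hφ hlam xs n _)
  have hcov : posteriorCov k lam xs n (xs (n + 1)) (xs (n + 1)) = k (xs (n + 1)) (xs (n + 1)) -
    kernelVec k xs n (xs (n + 1)) ⬝ᵥ
      ((regMatrix k lam xs n)⁻¹ *ᵥ kernelVec k xs n (xs (n + 1))) := rfl
  have hmean : posteriorMean k lam xs zs n (xs (n + 1)) = kernelVec k xs n (xs (n + 1)) ⬝ᵥ
    ((regMatrix k lam xs n)⁻¹ *ᵥ (fun i : Fin n => zs (i + 1))) := rfl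
  have hcomm := dotProduct_inv_regMatrix_comm hφ hlam xs n
    (kernelVec k xs n (xs (n + 1))) (fun i : Fin n => zs (i + 1))
  have hu := regMatrix_mulVec_inv_mulVec hφ hlam xs n (fun i : Fin n => zs (i + 1))
  have hw := regMatrix_mulVec_inv_mulVec hφ hlam xs n (kernelVec k xs n (xs (n + 1)))
  rw [noiseQuad, noiseQuad]
  rw [← hmean] at hcomm
  generalize posteriorCov k lam xs n (xs (n + 1)) (xs (n + 1)) = c at *
  generalize posteriorMean k lam xs zs n (xs (n + 1)) = a at *
  generalize (regMatrix k lam xs n)⁻¹ *ᵥ (fun i : Fin n => zs (i + 1)) = u at *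
  generalize (regMatrix k lam xs n)⁻¹ *ᵥ kernelVec k xs n (xs (n + 1)) = w at *
  -- Block elimination: the last coordinate of the new solution is the prediction error over the
  -- Schur complement, and the old coordinates `u` shift by `-r w`.
  obtain ⟨r, hr⟩ : ∃ r, r = (zs (n + 1) - a) / (lam + c) := ⟨_, rfl⟩
  have hrs : r * (lam + c) = zs (n + 1) - a := by rw [hr, div_mul_cancel₀ _ hs.ne']
  have hsol : regMatrix k lam xs (n + 1) *ᵥ (Fin.snoc (u - r • w) r : Fin (n + 1) → ℝ) =
      fun i : Fin (n + 1) => zs (i + 1) := by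
    rw [regMatrix_mulVec] at hu hw
    funext i
    rw [regMatrix_mulVec]
    refine Fin.lastCases ?_ (fun i => ?_) i
    · have h1 : (kernelMatrix k xs (n + 1) *ᵥ (Fin.snoc (u - r • w) r : Fin (n + 1) → ℝ))
          (Fin.last n) = kernelVec k xs n (xs (n + 1)) ⬝ᵥ (u - r • w) +
            k (xs (n + 1)) (xs (n + 1)) * r := by
        rw [mulVec, dotProduct, Fin.sum_univ_castSucc]
        simp [kernelMatrix, kernelVec, dotProduct, hφ, real_inner_comm]
      rw [Pi.add_apply, h1, dotProduct_sub, dotProduct_smul, ← hmean]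
      simp only [Pi.smul_apply, Fin.snoc_last, smul_eq_mul, Fin.val_last]
      linear_combination hrs - r * hcov
    · have h1 : (kernelMatrix k xs (n + 1) *ᵥ (Fin.snoc (u - r • w) r : Fin (n + 1) → ℝ))
          i.castSucc = (kernelMatrix k xs n *ᵥ (u - r • w)) i +
            kernelVec k xs n (xs (n + 1)) i * r := by
        rw [mulVec, dotProduct, Fin.sum_univ_castSucc]
        simp [kernelMatrix, kernelVec, mulVec, dotProduct]
      have hui := congrFun hu i
      have hwi := congrFun hw i
      simp only [Pi.add_apply, Pi.smul_apply, smul_eq_mul] at hui hwi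
      rw [Pi.add_apply, h1, mulVec_sub, mulVec_smul]
      simp only [Pi.sub_apply, Pi.smul_apply, Fin.snoc_castSucc, smul_eq_mul, Fin.val_castSucc]
      linear_combination hui - r * hwi
  have hinv : (regMatrix k lam xs (n + 1))⁻¹ *ᵥ (fun i : Fin (n + 1) => zs (i + 1)) =
      (Fin.snoc (u - r • w) r : Fin (n + 1) → ℝ) := by
    rw [← hsol, mulVec_mulVec, nonsing_inv_mul _ (isUnit_det_regMatrix hφ hlam xs (n + 1)),
      one_mulVec]
  have hsum (g : Fin (n + 1) → ℝ) : (fun i : Fin (n + 1) => zs (i + 1)) ⬝ᵥ g =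
      (fun i : Fin n => zs (i + 1)) ⬝ᵥ (fun i => g i.castSucc) + zs (n + 1) * g (Fin.last n) := by
    rw [dotProduct, Fin.sum_univ_castSucc]
    simp [dotProduct]
  have hsnoc : (fun i : Fin n => (Fin.snoc (u - r • w) r : Fin (n + 1) → ℝ) i.castSucc) =
      u - r • w := by
    funext i
    simp
  rw [hinv, hsum, hsum, hsnoc, Fin.snoc_last, dotProduct_sub, dotProduct_smul, ← hcomm,
    mul_div_assoc]
  have : (zs (n + 1) - a) ^ 2 / (lam + c) = r * (zs (n + 1) - a) := by rw [hr]; ring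
  rw [this]
  simp only [Fin.val_castSucc, Fin.val_last, smul_eq_mul]
  ring

end FeatureMap

end RobustSatisficing

end

noncomputable section

namespace RobustSatisficing

open ProbabilityTheory Filter
open scoped ENNReal NNReal Topology

/-! ### A Gaussian mixture -/

/-- The Gaussian mixture of `exp (w z / R² - w² / (2 R²))` over `w ∼ N(a, R² v)`. -/
def mixtureFactor (R a v z : ℝ) : ℝ :=
  (√(1 + v))⁻¹ * Real.exp ((2 * z * a + z ^ 2 * v - a ^ 2) / (2 * R ^ 2 * (1 + v)))

theorem mixtureFactor_pos {R a v z : ℝ} (hv : 0 ≤ v) : 0 < mixtureFactor R a v z := by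
  have : 0 < 1 + v := by linarith
  rw [mixtureFactor]
  positivity

theorem lintegral_exp_gaussianReal {R a v : ℝ} (hR : 0 < R) (hv : 0 ≤ v) (z : ℝ) :
    ∫⁻ g, ENNReal.ofReal (Real.exp ((a + √v * R * g) / R ^ 2 * z -
      ((a + √v * R * g) / R ^ 2) ^ 2 * R ^ 2 / 2)) ∂gaussianReal 0 1 =
      ENNReal.ofReal (mixtureFactor R a v z) := by
  have h1 : 0 < 1 + v := by linarith
  have hvar : (Real.toNNReal (1 / (1 + v))) ≠ 0 := by
    rw [Ne, Real.toNNReal_eq_zero, not_le]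
    positivity
  rw [gaussianReal_of_var_ne_zero _ one_ne_zero,
    lintegral_withDensity_eq_lintegral_mul _ (measurable_gaussianPDF _ _) (by fun_prop)]
  -- Completing the square in `g`: the integrand is a constant times a Gaussian density of mean `√v
  -- (z - a) / (R (1 + v))` and variance `1 / (1 + v)`.
  have hpt : ∀ g : ℝ, (gaussianPDF 0 1 * fun g => ENNReal.ofReal (Real.exp
      ((a + √v * R * g) / R ^ 2 * z - ((a + √v * R * g) / R ^ 2) ^ 2 * R ^ 2 / 2))) g =
      ENNReal.ofReal (mixtureFactor R a v z) *
        gaussianPDF (√v * (z - a) / (R * (1 + v))) (Real.toNNReal (1 / (1 + v))) g := by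
    intro g
    rw [Pi.mul_apply, gaussianPDF, gaussianPDF, ← ENNReal.ofReal_mul (gaussianPDFReal_nonneg _ _ _),
      ← ENNReal.ofReal_mul (mixtureFactor_pos hv).le]
    congr 1
    rw [gaussianPDFReal, gaussianPDFReal, mixtureFactor,
      Real.coe_toNNReal _ (by positivity : 0 ≤ 1 / (1 + v))]
    have hs : √(2 * Real.pi * (1 / (1 + v))) = √(2 * Real.pi) * (√(1 + v))⁻¹ := by
      rw [Real.sqrt_mul (by positivity), one_div, Real.sqrt_inv]
    have hsv : √(1 + v) ≠ 0 := (Real.sqrt_pos.2 h1).ne'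
    rw [hs, mul_inv, inv_inv, NNReal.coe_one, mul_one, mul_assoc, ← Real.exp_add]
    have harr : (√(1 + v))⁻¹ * Real.exp ((2 * z * a + z ^ 2 * v - a ^ 2) / (2 * R ^ 2 * (1 + v))) *
        ((√(2 * Real.pi))⁻¹ * √(1 + v) *
          Real.exp (-(g - √v * (z - a) / (R * (1 + v))) ^ 2 / (2 * (1 / (1 + v))))) =
        (√(2 * Real.pi))⁻¹ * Real.exp ((2 * z * a + z ^ 2 * v - a ^ 2) / (2 * R ^ 2 * (1 + v)) +
          -(g - √v * (z - a) / (R * (1 + v))) ^ 2 / (2 * (1 / (1 + v)))) := by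
      rw [Real.exp_add]
      field_simp
    rw [harr]
    congr 2
    obtain ⟨q, hq⟩ : ∃ q, q = √v := ⟨_, rfl⟩
    have hq2 : v = q ^ 2 := by rw [hq, Real.sq_sqrt hv]
    rw [← hq, hq2] at *
    field_simp
    ring
  rw [lintegral_congr hpt, lintegral_const_mul _ (measurable_gaussianPDF _ _),
    lintegral_gaussianPDF_eq_one _ hvar, mul_one]

/-! ### Conditionally sub-Gaussian variables -/

section Subgaussian

variable {Ω : Type*} {m mΩ : MeasurableSpace Ω} {P : Measure Ω} [IsProbabilityMeasure P]
  {R : ℝ} {X : Ω → ℝ}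

theorem IsCondSubgaussian.setLIntegral_exp_le (hX : IsCondSubgaussian P m R X) (hm : m ≤ mΩ)
    (s : ℝ) {A : Set Ω} (hA : MeasurableSet[m] A) :
    ∫⁻ ω in A, ENNReal.ofReal (Real.exp (s * X ω - s ^ 2 * R ^ 2 / 2)) ∂P ≤ P A := by
  obtain ⟨hint, hle⟩ := hX s
  have h1 : ∫ ω in A, Real.exp (s * X ω) ∂P ≤ Real.exp (s ^ 2 * R ^ 2 / 2) * P.real A := by
    rw [← setIntegral_condExp hm hint hA]
    refine (setIntegral_mono_ae integrable_condExp.integrableOn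
      (integrable_const _).integrableOn hle).trans ?_
    rw [setIntegral_const, smul_eq_mul, mul_comm]
  have hi : Integrable (fun ω => Real.exp (s * X ω - s ^ 2 * R ^ 2 / 2)) (P.restrict A) := by
    simp only [Real.exp_sub]
    exact (hint.div_const _).integrableOn
  rw [← ofReal_integral_eq_lintegral_ofReal hi (ae_of_all _ fun ω => (Real.exp_pos _).le),
    ← ofReal_measureReal]
  refine ENNReal.ofReal_le_ofReal ?_
  simp only [Real.exp_sub, integral_div]
  rw [div_le_iff₀ (Real.exp_pos _), mul_comm]
  exact h1

theorem IsCondSubgaussian.lintegral_mul_exp_le (hX : IsCondSubgaussian P m R X) (hm : m ≤ mΩ)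
    (hXm : Measurable X) (s : ℝ) {Z : Ω → ℝ≥0∞} (hZ : Measurable[m] Z) :
    ∫⁻ ω, Z ω * ENNReal.ofReal (Real.exp (s * X ω - s ^ 2 * R ^ 2 / 2)) ∂P ≤ ∫⁻ ω, Z ω ∂P := by
  have he : Measurable fun ω => ENNReal.ofReal (Real.exp (s * X ω - s ^ 2 * R ^ 2 / 2)) := by
    fun_prop
  -- The exponentially tilted measure is dominated by `P` on the sets of `m`, hence also when
  -- integrating `m`-measurable functions.
  have hle : (P.withDensity fun ω => ENNReal.ofReal
      (Real.exp (s * X ω - s ^ 2 * R ^ 2 / 2))).trim hm ≤ P.trim hm := by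
    refine Measure.le_iff.2 fun A hA => ?_
    rw [trim_measurableSet_eq hm hA, trim_measurableSet_eq hm hA, withDensity_apply _ (hm A hA)]
    exact hX.setLIntegral_exp_le hm s hA
  have h := lintegral_mono' hle (le_refl Z)
  rw [lintegral_trim hm hZ, lintegral_trim hm hZ,
    lintegral_withDensity_eq_lintegral_mul _ he (hZ.mono hm le_rfl)] at h
  simpa only [Pi.mul_apply, mul_comm] using h

/-- On each of the finitely many fibres of `W` the multiplier is a constant, to which the previous
bound applies. -/
theorem IsCondSubgaussian.lintegral_mul_exp_finite_range_le (hX : IsCondSubgaussian P m R X)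
    (hm : m ≤ mΩ) (hXm : Measurable X) {W : Ω → ℝ} (hW : Measurable[m] W)
    (hfin : (Set.range W).Finite) {Z : Ω → ℝ≥0∞} (hZ : Measurable[m] Z) :
    ∫⁻ ω, Z ω * ENNReal.ofReal (Real.exp (W ω * X ω - W ω ^ 2 * R ^ 2 / 2)) ∂P ≤
      ∫⁻ ω, Z ω ∂P := by
  have hfib (s : ℝ) : MeasurableSet[m] (W ⁻¹' {s}) := hW (measurableSet_singleton s)
  have hZs (s : ℝ) : Measurable[m] ((W ⁻¹' {s}).indicator Z) := hZ.indicator (hfib s)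
  have hsum (F : Ω → ℝ≥0∞) (ω : Ω) :
      ∑ s ∈ hfin.toFinset, (W ⁻¹' {s}).indicator F ω = F ω := by
    rw [Finset.sum_eq_single_of_mem (W ω) (by simp)]
    · exact Set.indicator_of_mem (by simp) F
    · intro s _ hs
      exact Set.indicator_of_notMem (by simpa using hs.symm) F
  calc ∫⁻ ω, Z ω * ENNReal.ofReal (Real.exp (W ω * X ω - W ω ^ 2 * R ^ 2 / 2)) ∂P
      = ∫⁻ ω, ∑ s ∈ hfin.toFinset, (W ⁻¹' {s}).indicator Z ω *
          ENNReal.ofReal (Real.exp (s * X ω - s ^ 2 * R ^ 2 / 2)) ∂P := by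
        refine lintegral_congr fun ω => ?_
        rw [← hsum (fun ω => Z ω * ENNReal.ofReal (Real.exp (W ω * X ω - W ω ^ 2 * R ^ 2 / 2))) ω]
        refine Finset.sum_congr rfl fun s _ => ?_
        by_cases h : ω ∈ W ⁻¹' {s}
        · rw [Set.indicator_of_mem h, Set.indicator_of_mem h, show W ω = s from h]
        · rw [Set.indicator_of_notMem h, Set.indicator_of_notMem h, zero_mul]
    _ = ∑ s ∈ hfin.toFinset, ∫⁻ ω, (W ⁻¹' {s}).indicator Z ω *
          ENNReal.ofReal (Real.exp (s * X ω - s ^ 2 * R ^ 2 / 2)) ∂P :=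
        lintegral_finsetSum _ fun s _ => ((hZs s).mono hm le_rfl).mul (by fun_prop)
    _ ≤ ∑ s ∈ hfin.toFinset, ∫⁻ ω, (W ⁻¹' {s}).indicator Z ω ∂P :=
        Finset.sum_le_sum fun s _ => hX.lintegral_mul_exp_le hm hXm s (hZs s)
    _ = ∫⁻ ω, Z ω ∂P := by
        rw [← lintegral_finsetSum _ fun s _ => (hZs s).mono hm le_rfl]
        exact lintegral_congr (hsum Z)

/-- Simple functions approximate `W` pointwise; since only an upper bound is wanted, Fatou's lemma
suffices for the limit. -/
theorem IsCondSubgaussian.lintegral_mul_exp_measurable_le (hX : IsCondSubgaussian P m R X)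
    (hm : m ≤ mΩ) (hXm : Measurable X) {W : Ω → ℝ} (hW : Measurable[m] W) {Z : Ω → ℝ≥0∞}
    (hZ : Measurable[m] Z) (hZtop : ∀ ω, Z ω ≠ ∞) :
    ∫⁻ ω, Z ω * ENNReal.ofReal (Real.exp (W ω * X ω - W ω ^ 2 * R ^ 2 / 2)) ∂P ≤
      ∫⁻ ω, Z ω ∂P := by
  have hW' : @StronglyMeasurable Ω ℝ _ m W := hW.stronglyMeasurable
  have hlim (ω : Ω) : Tendsto (fun n => Z ω * ENNReal.ofReal (Real.exp
      (hW'.approx n ω * X ω - hW'.approx n ω ^ 2 * R ^ 2 / 2))) atTop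
      (𝓝 (Z ω * ENNReal.ofReal (Real.exp (W ω * X ω - W ω ^ 2 * R ^ 2 / 2)))) := by
    refine ENNReal.Tendsto.const_mul ?_ (Or.inr (hZtop ω))
    refine ENNReal.tendsto_ofReal ?_
    have := hW'.tendsto_approx ω
    have hc : Continuous fun w : ℝ => Real.exp (w * X ω - w ^ 2 * R ^ 2 / 2) := by fun_prop
    exact (hc.tendsto _).comp this
  have hmeas (n : ℕ) : Measurable fun ω => Z ω * ENNReal.ofReal (Real.exp
      (hW'.approx n ω * X ω - hW'.approx n ω ^ 2 * R ^ 2 / 2)) := by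
    have h1 : Measurable (hW'.approx n) :=
      (@SimpleFunc.measurable _ _ m _ (hW'.approx n)).mono hm le_rfl
    have h2 : Measurable Z := hZ.mono hm le_rfl
    fun_prop
  calc ∫⁻ ω, Z ω * ENNReal.ofReal (Real.exp (W ω * X ω - W ω ^ 2 * R ^ 2 / 2)) ∂P
      = ∫⁻ ω, liminf (fun n => Z ω * ENNReal.ofReal (Real.exp
          (hW'.approx n ω * X ω - hW'.approx n ω ^ 2 * R ^ 2 / 2))) atTop ∂P :=
        lintegral_congr fun ω => (hlim ω).liminf_eq.symm
    _ ≤ liminf (fun n => ∫⁻ ω, Z ω * ENNReal.ofReal (Real.exp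
          (hW'.approx n ω * X ω - hW'.approx n ω ^ 2 * R ^ 2 / 2)) ∂P) atTop :=
        lintegral_liminf_le hmeas
    _ ≤ ∫⁻ ω, Z ω ∂P := by
        refine liminf_le_of_le (by isBoundedDefault) fun b hb => ?_
        obtain ⟨n, hn⟩ := hb.exists
        exact hn.trans (hX.lintegral_mul_exp_finite_range_le hm hXm
          (@SimpleFunc.measurable _ _ m _ (hW'.approx n))
          (@SimpleFunc.finite_range _ _ m (hW'.approx n)) hZ)

/-- By Tonelli the Gaussian variable `g` can be fixed first; then `(a + √v R g) / R²` is an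
`m`-measurable multiplier. -/
theorem IsCondSubgaussian.lintegral_mul_mixtureFactor_le (hX : IsCondSubgaussian P m R X)
    (hm : m ≤ mΩ) (hXm : Measurable X) (hR : 0 < R) {a v : Ω → ℝ} (ha : Measurable[m] a)
    (hv : Measurable[m] v) (hv0 : ∀ ω, 0 ≤ v ω) {Z : Ω → ℝ≥0∞}
    (hZ : Measurable[m] Z) (hZtop : ∀ ω, Z ω ≠ ∞) :
    ∫⁻ ω, Z ω * ENNReal.ofReal (mixtureFactor R (a ω) (v ω) (X ω)) ∂P ≤ ∫⁻ ω, Z ω ∂P := by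
  have hZ' : Measurable Z := hZ.mono hm le_rfl
  have ha' : Measurable a := ha.mono hm le_rfl
  have hv' : Measurable v := hv.mono hm le_rfl
  calc ∫⁻ ω, Z ω * ENNReal.ofReal (mixtureFactor R (a ω) (v ω) (X ω)) ∂P
      = ∫⁻ ω, ∫⁻ g, Z ω * ENNReal.ofReal (Real.exp ((a ω + √(v ω) * R * g) / R ^ 2 * X ω -
          ((a ω + √(v ω) * R * g) / R ^ 2) ^ 2 * R ^ 2 / 2)) ∂gaussianReal 0 1 ∂P := by
        refine lintegral_congr fun ω => ?_
        rw [lintegral_const_mul _ (by fun_prop), lintegral_exp_gaussianReal hR (hv0 ω)]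
    _ = ∫⁻ g, ∫⁻ ω, Z ω * ENNReal.ofReal (Real.exp ((a ω + √(v ω) * R * g) / R ^ 2 * X ω -
          ((a ω + √(v ω) * R * g) / R ^ 2) ^ 2 * R ^ 2 / 2)) ∂P ∂gaussianReal 0 1 := by
        refine lintegral_lintegral_swap (Measurable.aemeasurable ?_)
        simp only [Function.uncurry_def]
        fun_prop
    _ ≤ ∫⁻ _, ∫⁻ ω, Z ω ∂P ∂gaussianReal 0 1 := by
        refine lintegral_mono fun g => ?_
        exact hX.lintegral_mul_exp_measurable_le hm hXm
          (W := fun ω => (a ω + √(v ω) * R * g) / R ^ 2) (by fun_prop) hZ hZtop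
    _ = ∫⁻ ω, Z ω ∂P := by simp

end Subgaussian

/-! ### A maximal inequality -/

/-- A maximal inequality for nonnegative supermartingales that are adapted up to time `T`. -/
theorem measure_exists_le_of_setLIntegral_le {Ω : Type*} {mΩ : MeasurableSpace Ω} {P : Measure Ω}
    [IsProbabilityMeasure P] (ℱ : Filtration ℕ mΩ) (M : ℕ → Ω → ℝ≥0∞) (T : ℕ)
    (hM0 : ∀ ω, M 0 ω = 1) (hM : ∀ n ≤ T, Measurable[ℱ n] (M n))
    (hstep : ∀ n < T, ∀ A, MeasurableSet[ℱ n] A → ∫⁻ ω in A, M (n + 1) ω ∂P ≤ ∫⁻ ω in A, M n ω ∂P)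
    {c : ℝ≥0∞} (hc : 1 < c) :
    c * P {ω | ∃ n ≤ T, c ≤ M n ω} ≤ 1 := by
  have hmeas : ∀ n ≤ T, MeasurableSet[ℱ n] {ω | ∃ i ≤ n, c ≤ M i ω} := by
    intro n hn
    have : {ω | ∃ i ≤ n, c ≤ M i ω} = ⋃ i ∈ Finset.range (n + 1), {ω | c ≤ M i ω} := by
      ext ω
      simp [-Order.lt_add_one_iff, Nat.lt_succ_iff]
    rw [this]
    refine Finset.measurableSet_biUnion _ fun i hi => ?_
    have hin : i ≤ n := Nat.lt_succ_iff.1 (Finset.mem_range.1 hi)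
    exact ℱ.mono hin _ ((hM i (hin.trans hn)) measurableSet_Ici)
  -- The process is stopped at its first crossing of `c`: paths that have crossed count as `c`, the
  -- others carry their current value. At time 0 none has crossed, because `c > 1`.
  have key : ∀ n ≤ T, c * P {ω | ∃ i ≤ n, c ≤ M i ω} +
      ∫⁻ ω in {ω | ∃ i ≤ n, c ≤ M i ω}ᶜ, M n ω ∂P ≤ 1 := by
    intro n
    induction n with
    | zero =>
      intro _
      have h0 : {ω | ∃ i ≤ 0, c ≤ M i ω} = ∅ := by
        ext ω
        simp [hM0, hc]
      rw [h0]
      simp [hM0]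
    | succ n ih =>
      intro hn
      refine le_trans ?_ (ih (by omega))
      have hD := hmeas n (by omega)
      have hD1 := hmeas (n + 1) hn
      have hC : MeasurableSet {ω | c ≤ M (n + 1) ω} :=
        measurableSet_le measurable_const ((hM (n + 1) hn).mono (ℱ.le _) le_rfl)
      have hunion : {ω | ∃ i ≤ n + 1, c ≤ M i ω} =
          {ω | ∃ i ≤ n, c ≤ M i ω} ∪ {ω | c ≤ M (n + 1) ω} := by
        ext ω
        constructor
        · rintro ⟨i, hi, h⟩
          rcases Nat.le_succ_iff.1 hi with h' | rfl
          · exact Or.inl ⟨i, h', h⟩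
          · exact Or.inr h
        · rintro (⟨i, hi, h⟩ | h)
          · exact ⟨i, by omega, h⟩
          · exact ⟨n + 1, le_rfl, h⟩
      generalize {ω | ∃ i ≤ n, c ≤ M i ω} = D at *
      generalize {ω | ∃ i ≤ n + 1, c ≤ M i ω} = D' at *
      subst hunion
      have hDm : MeasurableSet D := ℱ.le n _ hD
      have hsplit := lintegral_inter_add_sdiff (μ := P) (M (n + 1)) Dᶜ hC
      have hcomp : (D ∪ {ω | c ≤ M (n + 1) ω})ᶜ = Dᶜ \ {ω | c ≤ M (n + 1) ω} := by
        rw [Set.compl_union, Set.sdiff_eq]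
      have hmarkov : c * P (Dᶜ ∩ {ω | c ≤ M (n + 1) ω}) ≤
          ∫⁻ ω in Dᶜ ∩ {ω | c ≤ M (n + 1) ω}, M (n + 1) ω ∂P := by
        rw [← setLIntegral_const]
        exact setLIntegral_mono' (hDm.compl.inter hC) fun ω hω => hω.2
      have hP : P (D ∪ {ω | c ≤ M (n + 1) ω}) ≤ P D + P (Dᶜ ∩ {ω | c ≤ M (n + 1) ω}) := by
        refine le_trans (measure_mono ?_) (measure_union_le _ _)
        intro ω hω
        by_cases h : ω ∈ D
        · exact Or.inl h
        · exact Or.inr ⟨h, hω.resolve_left h⟩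
      calc _ ≤ c * (P D + P (Dᶜ ∩ {ω | c ≤ M (n + 1) ω})) +
            ∫⁻ ω in Dᶜ \ {ω | c ≤ M (n + 1) ω}, M (n + 1) ω ∂P := by
            rw [hcomp]
            gcongr
        _ ≤ c * P D + (∫⁻ ω in Dᶜ ∩ {ω | c ≤ M (n + 1) ω}, M (n + 1) ω ∂P +
            ∫⁻ ω in Dᶜ \ {ω | c ≤ M (n + 1) ω}, M (n + 1) ω ∂P) := by
            rw [mul_add, add_assoc]
            gcongr
        _ = c * P D + ∫⁻ ω in Dᶜ, M (n + 1) ω ∂P := by rw [hsplit]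
        _ ≤ _ := by
            gcongr 1
            exact hstep n (by omega) _ hD.compl
  exact le_trans le_self_add (key T le_rfl)

/-- Ville's inequality for the product of the Gaussian mixtures of the noise. -/
theorem measure_exists_le_prod_mixtureFactor {Ω : Type*} {mΩ : MeasurableSpace Ω} {P : Measure Ω}
    [IsProbabilityMeasure P] (ℱ : Filtration ℕ mΩ) {R : ℝ} (hR : 0 < R) (T : ℕ)
    (a v η : ℕ → Ω → ℝ) (ha : ∀ n < T, Measurable[ℱ n] (a n)) (hv : ∀ n < T, Measurable[ℱ n] (v n))
    (hv0 : ∀ n ω, 0 ≤ v n ω) (hη : ∀ n < T, Measurable[ℱ (n + 1)] (η (n + 1)))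
    (hsub : ∀ n < T, IsCondSubgaussian P (ℱ n) R (η (n + 1))) {c : ℝ≥0∞} (hc : 1 < c) :
    (∀ n ≤ T, Measurable[ℱ n] fun ω =>
      ∏ i ∈ Finset.range n, mixtureFactor R (a i ω) (v i ω) (η (i + 1) ω)) ∧
    c * P {ω | ∃ n ≤ T, c ≤ ENNReal.ofReal
      (∏ i ∈ Finset.range n, mixtureFactor R (a i ω) (v i ω) (η (i + 1) ω))} ≤ 1 := by
  have hmeas : ∀ n ≤ T, Measurable[ℱ n] fun ω =>
      ∏ i ∈ Finset.range n, mixtureFactor R (a i ω) (v i ω) (η (i + 1) ω) := by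
    intro n hn
    refine Finset.measurable_prod _ fun i hi => ?_
    have hin : i < n := Finset.mem_range.1 hi
    have h1 : Measurable[ℱ n] (a i) := (ha i (by omega)).mono (ℱ.mono hin.le) le_rfl
    have h2 : Measurable[ℱ n] (v i) := (hv i (by omega)).mono (ℱ.mono hin.le) le_rfl
    have h3 : Measurable[ℱ n] (η (i + 1)) := (hη i (by omega)).mono (ℱ.mono hin) le_rfl
    unfold mixtureFactor
    fun_prop
  refine ⟨hmeas, measure_exists_le_of_setLIntegral_le ℱ _ T (fun ω => by simp)
    (fun n hn => (hmeas n hn).ennreal_ofReal) (fun n hn A hA => ?_) hc⟩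
  have hmul (ω : Ω) : ENNReal.ofReal (∏ i ∈ Finset.range (n + 1),
      mixtureFactor R (a i ω) (v i ω) (η (i + 1) ω)) =
      ENNReal.ofReal (∏ i ∈ Finset.range n, mixtureFactor R (a i ω) (v i ω) (η (i + 1) ω)) *
        ENNReal.ofReal (mixtureFactor R (a n ω) (v n ω) (η (n + 1) ω)) := by
    rw [Finset.prod_range_succ, ENNReal.ofReal_mul]
    exact Finset.prod_nonneg fun i _ => (mixtureFactor_pos (hv0 i ω)).le
  have hηn : Measurable (η (n + 1)) := (hη n hn).mono (ℱ.le _) le_rfl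
  have h := (hsub n hn).lintegral_mul_mixtureFactor_le (ℱ.le n)
    hηn hR (ha n hn) (hv n hn) (hv0 n)
    -- Putting the indicator of `A` into the `ℱ n`-measurable factor turns the global bound into the
    -- bound over `A`.
    (Z := A.indicator fun ω => ENNReal.ofReal
      (∏ i ∈ Finset.range n, mixtureFactor R (a i ω) (v i ω) (η (i + 1) ω)))
    ((hmeas n hn.le).ennreal_ofReal.indicator hA)
    (fun ω => by by_cases hω : ω ∈ A <;> simp [hω])
  have hAm : MeasurableSet A := ℱ.le n _ hA
  rw [lintegral_indicator hAm] at h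
  refine le_trans (le_of_eq ?_) h
  rw [← lintegral_indicator hAm]
  refine lintegral_congr fun ω => ?_
  by_cases hω : ω ∈ A
  · simp only [Set.indicator_of_mem hω, hmul]
  · simp only [Set.indicator_of_notMem hω, zero_mul]

end RobustSatisficing

end

noncomputable section

namespace RobustSatisficing

open Matrix
open scoped InnerProductSpace ENNReal

/-! ### Measurability of the posterior -/

theorem measurable_matrix_det {Ω ι : Type*} {_ : MeasurableSpace Ω} [Fintype ι] [DecidableEq ι]
    {A : Ω → Matrix ι ι ℝ} (hA : ∀ i j, Measurable fun ω => A ω i j) :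
    Measurable fun ω => (A ω).det := by
  simp only [det_apply']
  fun_prop

theorem measurable_matrix_inv {Ω ι : Type*} {_ : MeasurableSpace Ω} [Fintype ι] [DecidableEq ι]
    {A : Ω → Matrix ι ι ℝ} (hA : ∀ i j, Measurable fun ω => A ω i j) (i j : ι) :
    Measurable fun ω => (A ω)⁻¹ i j := by
  simp only [inv_def, Ring.inverse_eq_inv', Matrix.smul_apply, smul_eq_mul, adjugate_apply]
  refine (measurable_matrix_det hA).inv.mul (measurable_matrix_det fun p q => ?_)
  simp only [updateRow_apply]
  split_ifs
  · exact measurable_const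
  · exact hA p q

section

variable {Ω X : Type*} {mΩ : MeasurableSpace Ω} [MeasurableSpace X] {k : X → X → ℝ}
  {xs : ℕ → Ω → X} {n : ℕ} {x : Ω → X}

theorem measurable_kernelVec (hk : Measurable fun p : X × X => k p.1 p.2)
    (hxs : ∀ i, 1 ≤ i → i ≤ n → Measurable (xs i)) (hx : Measurable x) (i : Fin n) :
    Measurable fun ω => kernelVec k (fun i => xs i ω) n (x ω) i :=
  hk.comp ((hxs (i + 1) (by omega) (by omega)).prodMk hx)

theorem measurable_inv_regMatrix (hk : Measurable fun p : X × X => k p.1 p.2) (lam : ℝ)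
    (hxs : ∀ i, 1 ≤ i → i ≤ n → Measurable (xs i)) (i j : Fin n) :
    Measurable fun ω => (regMatrix k lam (fun i => xs i ω) n)⁻¹ i j := by
  refine measurable_matrix_inv (fun i j => ?_) i j
  exact (hk.comp ((hxs (i + 1) (by omega) (by omega)).prodMk
    (hxs (j + 1) (by omega) (by omega)))).add measurable_const

theorem measurable_posteriorMean (hk : Measurable fun p : X × X => k p.1 p.2) (lam : ℝ)
    (hxs : ∀ i, 1 ≤ i → i ≤ n → Measurable (xs i)) (hx : Measurable x) {zs : ℕ → Ω → ℝ}
    (hzs : ∀ i, 1 ≤ i → i ≤ n → Measurable (zs i)) :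
    Measurable fun ω => posteriorMean k lam (fun i => xs i ω) (fun i => zs i ω) n (x ω) := by
  simp only [posteriorMean, dotProduct, mulVec]
  refine Finset.measurable_sum _ fun i _ => (measurable_kernelVec hk hxs hx i).mul ?_
  exact Finset.measurable_sum _ fun j _ => (measurable_inv_regMatrix hk lam hxs i j).mul
    (hzs (j + 1) (by omega) (by omega))

theorem measurable_posteriorCov (hk : Measurable fun p : X × X => k p.1 p.2) (lam : ℝ)
    (hxs : ∀ i, 1 ≤ i → i ≤ n → Measurable (xs i)) (hx : Measurable x) :
    Measurable fun ω => posteriorCov k lam (fun i => xs i ω) n (x ω) (x ω) := by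
  simp only [posteriorCov, dotProduct, mulVec]
  refine (hk.comp (hx.prodMk hx)).sub ?_
  refine Finset.measurable_sum _ fun i _ => (measurable_kernelVec hk hxs hx i).mul ?_
  exact Finset.measurable_sum _ fun j _ => (measurable_inv_regMatrix hk lam hxs i j).mul
    (measurable_kernelVec hk hxs hx j)

end

/-! ### The confidence bounds -/

section

variable {X E : Type*} [NormedAddCommGroup E] [InnerProductSpace ℝ E] {k : X → X → ℝ} {φ : X → E}
  {lam : ℝ}

/-- Each factor is the ratio of the predictive density `N(a, R² (1 + v))` to `N(0, R²)` at the new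
noise value. By the chain rule the product is the ratio of the joint densities `N(0, R² (I + K /
λ))` and `N(0, R² I)`. -/
theorem prod_mixtureFactor_eq (hφ : ∀ x y, k x y = ⟪φ x, φ y⟫_ℝ) (hlam : 0 < lam) {R : ℝ}
    (hR : 0 < R) (xs : ℕ → X) (zs : ℕ → ℝ) (n : ℕ) :
    ∏ i ∈ Finset.range n, mixtureFactor R (posteriorMean k lam xs zs i (xs (i + 1)))
      (posteriorCov k lam xs i (xs (i + 1)) (xs (i + 1)) / lam) (zs (i + 1)) =
    (√((regMatrix k lam xs n).det / lam ^ n))⁻¹ *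
      Real.exp (noiseQuad k lam xs zs n / (2 * R ^ 2)) := by
  induction n with
  | zero => simp [noiseQuad]
  | succ n ih =>
    have hc := posteriorCov_self_nonneg hφ hlam xs n (xs (n + 1))
    have hdet : (regMatrix k lam xs (n + 1)).det / lam ^ (n + 1) =
        (regMatrix k lam xs n).det / lam ^ n *
          (1 + posteriorCov k lam xs n (xs (n + 1)) (xs (n + 1)) / lam) := by
      rw [det_regMatrix_succ hφ hlam, pow_succ]
      field_simp
    have hpos : 0 < (regMatrix k lam xs n).det / lam ^ n :=
      div_pos (posDef_regMatrix hφ hlam xs n).det_pos (by positivity)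
    rw [Finset.prod_range_succ, ih, mixtureFactor, hdet, Real.sqrt_mul hpos.le, mul_inv,
      mul_mul_mul_comm, ← Real.exp_add, noiseQuad_succ hφ hlam]
    congr 2
    generalize posteriorCov k lam xs n (xs (n + 1)) (xs (n + 1)) = c at *
    have h1 : lam + c ≠ 0 := by positivity
    have h2 : 1 + c / lam ≠ 0 := by positivity
    field_simp
    ring

theorem noiseQuad_le_of_prod_lt (hφ : ∀ x y, k x y = ⟪φ x, φ y⟫_ℝ) (hlam : 0 < lam) {R ζ : ℝ}
    (hR : 0 < R) (xs : ℕ → X) (zs : ℕ → ℝ) (n : ℕ)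
    (h : ∏ i ∈ Finset.range n, mixtureFactor R (posteriorMean k lam xs zs i (xs (i + 1)))
      (posteriorCov k lam xs i (xs (i + 1)) (xs (i + 1)) / lam) (zs (i + 1)) < 1 / ζ) :
    noiseQuad k lam xs zs n ≤
      R ^ 2 * (Real.log ((regMatrix k lam xs n).det / lam ^ n) + 2 * Real.log (1 / ζ)) := by
  have hpos : 0 < (regMatrix k lam xs n).det / lam ^ n :=
    div_pos (posDef_regMatrix hφ hlam xs n).det_pos (by positivity)
  rw [prod_mixtureFactor_eq hφ hlam hR] at h
  have hs := Real.sqrt_pos.2 hpos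
  have hlog := Real.log_le_log (by positivity) h.le
  rw [Real.log_mul (by positivity) (by positivity), Real.log_inv, Real.log_sqrt hpos.le,
    Real.log_exp] at hlog
  have h2 : noiseQuad k lam xs zs n / (2 * R ^ 2) ≤
      Real.log ((regMatrix k lam xs n).det / lam ^ n) / 2 + Real.log (1 / ζ) := by linarith
  rw [div_le_iff₀ (by positivity)] at h2
  linarith

/-- The matrix on the right is `K + λ I` scaled by `λ̄ / λ`, so the determinants differ by the
factor `λ̄ ^ n ≥ 1`. -/
theorem log_det_regMatrix_le (hφ : ∀ x y, k x y = ⟪φ x, φ y⟫_ℝ) (hlam : 0 < lam)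
    (xs : ℕ → X) (n : ℕ) :
    Real.log ((regMatrix k lam xs n).det / lam ^ n) ≤
      Real.log (((max 1 lam / lam) • kernelMatrix k xs n +
        max 1 lam • (1 : Matrix (Fin n) (Fin n) ℝ)).det) := by
  have hdet := (posDef_regMatrix hφ hlam xs n).det_pos
  have h : (max 1 lam / lam) • kernelMatrix k xs n + max 1 lam • (1 : Matrix (Fin n) (Fin n) ℝ) =
      (max 1 lam / lam) • regMatrix k lam xs n := by
    rw [regMatrix, smul_add, smul_smul, div_mul_cancel₀ _ hlam.ne']
  rw [h, det_smul, Fintype.card_fin, div_pow, div_mul_eq_mul_div, mul_div_assoc]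
  refine Real.log_le_log (by positivity) ?_
  exact le_mul_of_one_le_left (by positivity) (one_le_pow₀ (le_max_left _ _))

theorem abs_sub_posteriorMean_le_beta (hφ : ∀ x y, k x y = ⟪φ x, φ y⟫_ℝ) (hlam : 0 < lam)
    {B R ζ : ℝ} (hR : 0 < R) (xs : ℕ → X) (ys zs : ℕ → ℝ) (t : ℕ) (f : E)
    (hf : ‖f‖ ≤ B) (hy : ∀ i, 1 ≤ i → i ≤ t - 1 → ys i = ⟪φ (xs i), f⟫_ℝ + zs i)
    (h : ∏ i ∈ Finset.range (t - 1),
      mixtureFactor R (posteriorMean k lam xs zs i (xs (i + 1)))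
        (posteriorCov k lam xs i (xs (i + 1)) (xs (i + 1)) / lam) (zs (i + 1)) < 1 / ζ) (x : X) :
    |⟪φ x, f⟫_ℝ - posteriorMean k lam xs ys (t - 1) x| ≤
      beta k lam B R ζ xs t * posteriorStd k lam xs (t - 1) x := by
  refine (abs_sub_posteriorMean_add_le hφ hlam xs ys zs (t - 1) x f hy).trans ?_
  refine mul_le_mul_of_nonneg_right ?_ (Real.sqrt_nonneg _)
  have hq := noiseQuad_le_of_prod_lt hφ hlam hR xs zs (t - 1) h
  have hl := log_det_regMatrix_le hφ hlam xs (t - 1)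
  rw [beta]
  refine add_le_add hf ?_
  rw [Real.sqrt_div' _ hlam.le, div_mul_eq_mul_div]
  gcongr
  conv_rhs => rw [← Real.sqrt_sq hR.le, ← Real.sqrt_mul (sq_nonneg R)]
  refine Real.sqrt_le_sqrt (hq.trans ?_)
  gcongr

end

/-- This supplies the feature map of the regression lemmas: `φ x` is the kernel section at `x`. -/
theorem rkhsKernel_eq_inner {X : Type*} (H : Type*) [NormedAddCommGroup H] [InnerProductSpace ℝ H]
    [CompleteSpace H] [RKHS ℝ H X ℝ] (x y : X) :
    rkhsKernel H x y = ⟪RKHS.kerFun H x (1 : ℝ), RKHS.kerFun H y (1 : ℝ)⟫_ℝ := by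
  rw [real_inner_comm, ← RKHS.kernel_inner]
  simp [rkhsKernel]

/-- With probability at least `1 - ζ`, the confidence bounds of all rounds enclose `f`. -/
theorem exists_event_confidence_bounds {Ω : Type*} {mΩ : MeasurableSpace Ω} (P : Measure Ω)
    [IsProbabilityMeasure P] {X : Type*} [MeasurableSpace X] (H : Type*) [NormedAddCommGroup H]
    [InnerProductSpace ℝ H] [CompleteSpace H] [RKHS ℝ H X ℝ]
    (hk : Measurable fun p : X × X => rkhsKernel H p.1 p.2) (f : H) (B R lam ζ : ℝ) (hf : ‖f‖ ≤ B)
    (hR : 0 < R) (hlam : 0 < lam) (hζ : ζ ∈ Set.Ioo (0 : ℝ) 1) (T : ℕ) (ℱ : Filtration ℕ mΩ)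
    (x : ℕ → Ω → X) (y η : ℕ → Ω → ℝ)
    (hy : ∀ t ∈ Finset.Icc 1 T, ∀ ω, y t ω = f (x t ω) + η t ω)
    (hx : ∀ t ∈ Finset.Icc 1 T, Measurable[ℱ (t - 1)] (x t))
    (hη : ∀ t ∈ Finset.Icc 1 T, Measurable[ℱ t] (η t))
    (hsub : ∀ t ∈ Finset.Icc 1 T, IsCondSubgaussian P (ℱ (t - 1)) R (η t)) :
    ∃ G : Set Ω, MeasurableSet G ∧ ENNReal.ofReal (1 - ζ) ≤ P G ∧
      ∀ ω ∈ G, ∀ t ∈ Finset.Icc 1 T, ∀ z : X,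
        lcb (rkhsKernel H) lam B R ζ (fun i => x i ω) (fun i => y i ω) t z ≤ f z ∧
        f z ≤ ucb (rkhsKernel H) lam B R ζ (fun i => x i ω) (fun i => y i ω) t z := by
  have hφ : ∀ x y : X, rkhsKernel H x y =
    ⟪RKHS.kerFun H x (1 : ℝ), RKHS.kerFun H y (1 : ℝ)⟫_ℝ := rkhsKernel_eq_inner H
  -- The sample `x_{n+1}` is already known at time `n`, the noise only up to index `n`; hence the
  -- next prediction and its variance are `ℱ n`-measurable.
  have hxF (n i : ℕ) (h1 : 1 ≤ i) (hi : i ≤ n + 1) (hT : i ≤ T) : Measurable[ℱ n] (x i) :=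
    (hx i (Finset.mem_Icc.2 ⟨h1, hT⟩)).mono (ℱ.mono (by omega)) le_rfl
  have hηF (n i : ℕ) (h1 : 1 ≤ i) (hi : i ≤ n) (hT : i ≤ T) : Measurable[ℱ n] (η i) :=
    (hη i (Finset.mem_Icc.2 ⟨h1, hT⟩)).mono (ℱ.mono hi) le_rfl
  have hc : (1 : ℝ≥0∞) < ENNReal.ofReal (1 / ζ) := by
    rw [ENNReal.one_lt_ofReal]
    exact (one_lt_div hζ.1).2 hζ.2
  obtain ⟨hmeas, hville⟩ := measure_exists_le_prod_mixtureFactor (P := P) ℱ hR T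
    (fun n ω => posteriorMean (rkhsKernel H) lam (fun i => x i ω) (fun i => η i ω) n
      (x (n + 1) ω))
    (fun n ω => posteriorCov (rkhsKernel H) lam (fun i => x i ω) n (x (n + 1) ω)
      (x (n + 1) ω) / lam) η
    (fun n hn => measurable_posteriorMean hk lam
      (fun i h1 h2 => hxF n i h1 (by omega) (by omega)) (hxF n _ (by omega) le_rfl (by omega))
      (fun i h1 h2 => hηF n i h1 h2 (by omega)))
    (fun n hn => (measurable_posteriorCov hk lam
      (fun i h1 h2 => hxF n i h1 (by omega) (by omega))
      (hxF n _ (by omega) le_rfl (by omega))).div_const _)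
    (fun n ω => div_nonneg (posteriorCov_self_nonneg hφ hlam _ _ _) hlam.le)
    (fun n hn => hηF _ _ (by omega) le_rfl (by omega))
    (fun n hn => hsub (n + 1) (Finset.mem_Icc.2 ⟨by omega, by omega⟩)) hc
  -- The bad event: the supermartingale reaches `1 / ζ` by time `T`.
  obtain ⟨D, hD⟩ : ∃ D : Set Ω, D = {ω | ∃ n ≤ T, ENNReal.ofReal (1 / ζ) ≤ ENNReal.ofReal
      (∏ i ∈ Finset.range n, mixtureFactor R
        (posteriorMean (rkhsKernel H) lam (fun i => x i ω) (fun i => η i ω) i (x (i + 1) ω))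
        (posteriorCov (rkhsKernel H) lam (fun i => x i ω) i (x (i + 1) ω) (x (i + 1) ω) / lam)
        (η (i + 1) ω))} := ⟨_, rfl⟩
  have hDm : MeasurableSet D := by
    have : D = ⋃ n ∈ Finset.range (T + 1), {ω | ENNReal.ofReal (1 / ζ) ≤ ENNReal.ofReal
      (∏ i ∈ Finset.range n, mixtureFactor R
        (posteriorMean (rkhsKernel H) lam (fun i => x i ω) (fun i => η i ω) i (x (i + 1) ω))
        (posteriorCov (rkhsKernel H) lam (fun i => x i ω) i (x (i + 1) ω) (x (i + 1) ω) / lam)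
        (η (i + 1) ω))} := by
      ext ω
      simp [hD, -Order.lt_add_one_iff, Nat.lt_succ_iff]
    rw [this]
    refine Finset.measurableSet_biUnion _ fun n hn => measurableSet_le measurable_const ?_
    exact ((hmeas n (Nat.lt_succ_iff.1 (Finset.mem_range.1 hn))).mono (ℱ.le n)
      le_rfl).ennreal_ofReal
  have hPD : P D ≤ ENNReal.ofReal ζ := by
    rw [← hD, one_div, ENNReal.ofReal_inv_of_pos hζ.1, mul_comm,
      ← div_eq_mul_inv] at hville
    exact (ENNReal.div_le_iff (by simpa using hζ.1) ENNReal.ofReal_ne_top).1 hville |>.trans_eq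
      (one_mul _)
  refine ⟨Dᶜ, hDm.compl, ?_, fun ω hω t ht z => ?_⟩
  · rw [prob_compl_eq_one_sub hDm, ENNReal.ofReal_sub _ hζ.1.le, ENNReal.ofReal_one]
    gcongr
  · rw [Finset.mem_Icc] at ht
    rw [hD] at hω
    have hlt := not_le.1 fun h => hω ⟨t - 1, by omega, h⟩
    have hfx (z : X) : ⟪RKHS.kerFun H z (1 : ℝ), f⟫_ℝ = f z := by simp
    have key := abs_sub_posteriorMean_le_beta hφ hlam hR (fun i => x i ω) (fun i => y i ω)
      (fun i => η i ω) t f hf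
      (fun i h1 h2 => by rw [hfx]; exact hy i (Finset.mem_Icc.2 ⟨h1, by omega⟩) ω)
      ((ENNReal.ofReal_lt_ofReal_iff (one_div_pos.2 hζ.1)).1 hlt) z
    rw [hfx, abs_le] at key
    rw [lcb, ucb]
    constructor <;> linarith [key.1, key.2]

/-! ### Critical radii -/

section

variable {m : ℕ} {𝒳 : Set (EuclideanSpace ℝ (Fin m))} {d : 𝒳 → 𝒳 → ℝ} {τ : ℝ}

theorem ambiguityBall_mono {ε ε' : EReal} (h : ε ≤ ε') (x : 𝒳) :
    ambiguityBall d ε x ⊆ ambiguityBall d ε' x := by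
  rintro δ ⟨x', hδ, hx'⟩
  exact ⟨x', hδ, hx'.trans h⟩

/-- If its critical radius is attained, `g ≥ τ` on the critical ball. -/
theorem le_of_mem_ambiguityBall_criticalRadius {g : 𝒳 → ℝ} {x : 𝒳}
    (h : CriticalRadiusAttained d τ g x) {δ : EuclideanSpace ℝ (Fin m)}
    (hδ : δ ∈ ambiguityBall d (criticalRadius d τ g x) x) : τ ≤ g (perturb hδ) := by
  rcases (feasibleRadii d τ g x).eq_empty_or_nonempty with he | hne
  · obtain ⟨x', -, hx'⟩ := hδ
    rw [criticalRadius, he, Set.image_empty, sSup_empty, le_bot_iff] at hx'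
    exact absurd hx' (EReal.coe_ne_bot _)
  · obtain ⟨r, hr⟩ := h hne
    have hrad : criticalRadius d τ g x = r :=
      -- Attainment makes the critical radius itself feasible, so the whole closed ball is covered,
      -- boundary included.
      ((EReal.coe_strictMono.monotone.map_isGreatest hr)).isLUB.sSup_eq
    obtain ⟨x', rfl, hx'⟩ := hr.1
    have hδ' : δ ∈ ambiguityBall d (d x x') x := hrad ▸ hδ
    exact hx' δ hδ'

/-- A ball that strictly contains the critical ball of `g` contains a perturbation with `g ≤ τ`. -/
theorem exists_le_of_criticalRadius_ssubset {g : 𝒳 → ℝ} {x : 𝒳} {ε ε' : EReal}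
    (hε : criticalRadius d τ g x ≤ ε) (h : ambiguityBall d ε x ⊂ ambiguityBall d ε' x) :
    ∃ δ, ∃ hδ : δ ∈ ambiguityBall d ε' x, g (perturb hδ) ≤ τ := by
  obtain ⟨δ, ⟨x', hδ, hx'⟩, hnot⟩ := Set.exists_of_ssubset h
  by_contra hcon
  push Not at hcon
  -- If `g > τ` on the larger ball, then `d x x'` is feasible, hence at most the critical radius,
  -- and `δ` would lie in the smaller ball.
  refine hnot ⟨x', hδ, le_trans (le_sSup ?_) hε⟩
  exact ⟨d x x', ⟨x', rfl, fun δ' hδ' => (hcon δ' (ambiguityBall_mono hx' x hδ')).le⟩, rfl⟩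

end

end RobustSatisficing

end

/-! ### The claim on the confidence event -/

theorem mainTheorem7 {Ω : Type*} [MeasurableSpace Ω] (P : Measure Ω) [IsProbabilityMeasure P]
    {m : ℕ} (𝒳 : Set (EuclideanSpace ℝ (Fin m)))
    (d : 𝒳 → 𝒳 → ℝ) (hd : RobustSatisficing.IsPseudometric d)
    (H : Type*) [NormedAddCommGroup H] [InnerProductSpace ℝ H] [CompleteSpace H] [RKHS ℝ H 𝒳 ℝ]
    (hk : Measurable fun p : 𝒳 × 𝒳 => RobustSatisficing.rkhsKernel H p.1 p.2)
    (f : H) (B R lam ζ τ : ℝ) (hB : 0 < B) (hf : ‖f‖ ≤ B) (hR : 0 < R) (hlam : 0 < lam)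
    (hζ : ζ ∈ Set.Ioo (0 : ℝ) 1) (hτ : ∃ x : 𝒳, τ ≤ f x) (T : ℕ)
    (ℱ : Filtration ℕ (inferInstance : MeasurableSpace Ω)) (ε : ℕ → Ω → ℝ)
    (xt : ℕ → Ω → 𝒳) (δ : ℕ → Ω → EuclideanSpace ℝ (Fin m)) (x : ℕ → Ω → 𝒳) (y η : ℕ → Ω → ℝ)
    (hrun : RobustSatisficing.IsAdveRS2Run P d (RobustSatisficing.rkhsKernel H) (⇑f)
      τ lam B R ζ T ℱ ε xt δ x y η) :
    ∃ G : Set Ω, MeasurableSet G ∧ ENNReal.ofReal (1 - ζ) ≤ P G ∧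
      ∀ ω ∈ G, ∀ t ∈ Finset.Icc 1 T,
        let UCB : 𝒳 → ℝ := RobustSatisficing.ucb (RobustSatisficing.rkhsKernel H) lam B R ζ
          (fun i => x i ω) (fun i => y i ω) t
        let LCB : 𝒳 → ℝ := RobustSatisficing.lcb (RobustSatisficing.rkhsKernel H) lam B R ζ
          (fun i => x i ω) (fun i => y i ω) t
        let optimisticBall := RobustSatisficing.ambiguityBall d
          (RobustSatisficing.maxCriticalRadius d τ UCB) (xt t ω)
        (RobustSatisficing.CriticalRadiusAttained d τ LCB (xt t ω) →
          ∀ δ', ∀ hδ' : δ' ∈ RobustSatisficing.ambiguityBall d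
            (RobustSatisficing.criticalRadius d τ LCB (xt t ω)) (xt t ω),
            τ ≤ f (RobustSatisficing.perturb hδ')) ∧
        (RobustSatisficing.ambiguityBall d
            (RobustSatisficing.criticalRadius d τ f (xt t ω)) (xt t ω) ⊂ optimisticBall →
          ∃ δ', ∃ hδ' : δ' ∈ optimisticBall, f (RobustSatisficing.perturb hδ') ≤ τ) ∧
        (RobustSatisficing.ambiguityBall d
            (RobustSatisficing.maxCriticalRadius d τ f) (xt t ω) ⊂ optimisticBall →
          ∃ δ', ∃ hδ' : δ' ∈ optimisticBall, f (RobustSatisficing.perturb hδ') ≤ τ) := by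
  obtain ⟨G, hG, hPG, hbounds⟩ := RobustSatisficing.exists_event_confidence_bounds P H hk f B R
    lam ζ hf hR hlam hζ T ℱ x y η hrun.observation hrun.measurable_sample hrun.measurable_noise
    hrun.noise
  refine ⟨G, hG, hPG, fun ω hω t ht => ⟨fun hatt δ' hδ' => ?_, fun h => ?_, fun h => ?_⟩⟩
  · exact (RobustSatisficing.le_of_mem_ambiguityBall_criticalRadius hatt hδ').trans
      (hbounds ω hω t ht _).1
  · exact RobustSatisficing.exists_le_of_criticalRadius_ssubset le_rfl h
  · exact RobustSatisficing.exists_le_of_criticalRadius_ssubset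
      (le_iSup (RobustSatisficing.criticalRadius d τ f) (xt t ω)) h
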